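/- **Setting.** Let $\mathcal Y=[0,1]^d$, let $\mathcal A$ be a finite action set, $\mathcal X$ a measurable feature space, and let $\mathcal N$ be a finite family of agents, each with a utility $u:\mathcal A\times\mathcal Y\to[0,1]$ and constraints $c_1,\dots,c_J:\mathcal A\times\mathcal Y\to[-1,1]$, measurable in $y$. For $C\subseteq\mathcal A$ nonempty let $\mathrm{CBR}^u_C(p)\in\arg\max_{a\in C}u(a,p)$, with ties broken by any fixed measurable rule of the agent ($\mathrm{CBR}^u_\emptyset(p)\in\mathcal A$ is arbitrary, but also fixed and measurable). In each round $t=1,\dots,T$ an adversary selects a feature $x_t\in\mathcal X$ and an outcome $y_t\in\mathcal Y$, possibly at random and depending on the past; the forecaster sees $x_t$ and the past transcript $\pi^{<t}=(x_s,p_s,y_s)_{s<t}$ and samples $p_t$ from a distribution $\psi_t$ on $\mathcal Y$ (independently of $y_t$, given $\pi^{<t}$ and $x_t$); then $y_t$ is revealed. Each agent keeps a candidate set $\widehat{\mathcal A}^{\mathbf c}_1=\mathcal A$, $\widehat{\mathcal A}^{\mathbf c}_{t+1}=\widehat{\mathcal A}^{\mathbf c}_t\setminus\{a:\exists j,\ c_j(a,y_t)>0\}$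 and plays $\mathrm{CBR}^u_{\widehat{\mathcal A}^{\mathbf c}_t}(p_t)$. **Unbiased-Prediction** with a finite family $\mathcal E$ of events $E(\pi^{<t},x_t,p_t)\in[0,1]$, learning rate $\eta>0$ and tolerance $\varepsilon\ge 0$: in round $t$ let, for $E\in\mathcal E$, $i\in[d]$, $\sigma\in\{\pm1\}$, $$q_t^{E,i,\sigma}\propto\exp\Big(\tfrac{\eta}{2}\sum_{s<t}\sigma\,\mathbb E_{p\sim\psi_s}\big[E(\pi^{<s},x_s,p)(p^i-y_s^i)\big]\Big),$$ and let $\psi_t$ be a distribution on $\mathcal Y$ that minimizes, up to the additive tolerance $\varepsilon$, $$\psi\mapsto\max_{y\in\mathcal Y}\ \mathbb E_{p\sim\psi}\Big[\sum_{E,i,\sigma}q_t^{E,i,\sigma}\,\sigma\,E(\pi^{<t},x_t,p)(p^i-y^i)\Big].$$ (The exact algorithm is the case $\varepsilon=0$. As a function of the past transcript and the feature, $\psi_t$ is a probability kernel.) **Theorem.** There is an absolute constant $K>0$ such that for all $d,\mathcal A,\mathcal N,J,T,\mathcal X$ as above with $d|\mathcal A||\mathcal N|T\ge2$ the following holds.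 Take the events $\mathbf 1[\mathrm{CBR}^u_{\widehat{\mathcal A}^{\mathbf c}_t}(p_t)=a]$ for $(u,\mathbf c)\in\mathcal N$, $a\in\mathcal A$. There is a learning rate $\eta>0$ such that Unbiased-Prediction with these events can be realized with every tolerance $\varepsilon>0$, and such that every realization of it with tolerance $1/T$ (in particular every one with a smaller tolerance, and every exact one) satisfies, for every adversary and every $\delta\in(0,1)$: with probability at least $1-\delta$, simultaneously for all $(u,\mathbf c)\in\mathcal N$ and all $a\in\mathcal A$, $$\Big\|\sum_{t=1}^T\mathbf 1[\mathrm{CBR}^u_{\widehat{\mathcal A}^{\mathbf c}_t}(p_t)=a](p_t-y_t)\Big\|_\infty\le K\Big(\ln(d|\mathcal A||\mathcal N|T)+\sqrt{\ln(d|\mathcal A||\mathcal N|T)\,T^{u,\mathbf c}(a)}+\sqrt{\ln\tfrac{d|\mathcal A||\mathcal N|}{\delta}\,T}\Big),$$ where $T^{u,\mathbf c}(a)=\sum_{t=1}^T\mathbf 1[\mathrm{CBR}^u_{\widehat{\mathcal A}^{\mathbf c}_t}(p_t)=a]$. -/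

import Mathlib

open MeasureTheory ProbabilityTheory Finset

noncomputable section

namespace DecisionCalibration

/-- The prediction / outcome space `𝒴 = [0,1]^d`. -/
abbrev Cube (d : ℕ) : Type := Fin d → unitInterval

/-- The realized triple `(x, p, y)` of one round: feature, prediction, outcome. -/
abbrev Round (X : Type*) (d : ℕ) := X × Cube d × Cube d

/-- A transcript of the first `t` rounds. Rounds are numbered from `0`, so this is what is known
at the beginning of round `t`. -/
abbrev Transcript (X : Type*) (d t : ℕ) := Fin t → Round X d

/-- The transcript of the rounds before round `s`. -/
def Transcript.before {X : Type*} {d t : ℕ} (h : Transcript X d t) (s : Fin t) :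
    Transcript X d s :=
  fun r => h (Fin.castLE s.isLt.le r)

/-! ### Agents -/

/-- An agent: a utility `u : 𝒜 × 𝒴 → [0,1]` and constraints `c_j : 𝒜 × 𝒴 → [-1,1]`. -/
structure Agent (d J : ℕ) (A : Type*) where
  u : A → Cube d → unitInterval
  c : Fin J → A → Cube d → Set.Icc (-1 : ℝ) 1
  measurable_c : ∀ j a, Measurable (c j a)

/-- `cbr` is the constrained best response of a utility function `u`: `cbr C p` is an element of
`argmax_{a ∈ C} u(a, p)` for every nonempty `C`. Ties are broken by any fixed measurable rule;
the value for `C = ∅` is unconstrained. -/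
structure IsConstrainedBestResponse {d : ℕ} {A : Type*} (u : A → Cube d → unitInterval)
    (cbr : Finset A → Cube d → A) : Prop where
  mem : ∀ C : Finset A, C.Nonempty → ∀ p, cbr C p ∈ C
  le : ∀ C : Finset A, ∀ p, ∀ b ∈ C, u b p ≤ u (cbr C p) p
  measurableSet : ∀ (C : Finset A) (a : A), MeasurableSet {p | cbr C p = a}

open Classical in
/-- The candidate action set maintained by the elimination algorithm: all actions at the start,
and after each round every action that violated a constraint at the outcome of that round is
removed. -/
def candidates {X A : Type*} [Fintype A] {d J : ℕ} (g : Agent d J A) :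
    (t : ℕ) → Transcript X d t → Finset A
  | 0, _ => Finset.univ
  | t + 1, h =>
      (candidates g t (Fin.init h)).filter
        fun a => ¬ ∃ j, 0 < (g.c j a (h (Fin.last t)).2.2 : ℝ)

/-! ### The algorithm Unbiased-Prediction -/

/-- An event: a map from transcripts, features and predictions to `[0,1]`. -/
abbrev Event (X : Type*) (d : ℕ) := (t : ℕ) → Transcript X d t → X → Cube d → unitInterval

/-- A (randomized, online) forecaster: in round `t` it maps the transcript of the past rounds and
the current feature to a probability distribution over predictions. -/
structure Forecaster (X : Type*) [MeasurableSpace X] (d : ℕ) where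
  ker : (t : ℕ) → Kernel (Transcript X d t × X) (Cube d)
  isMarkov : ∀ t, IsMarkovKernel (ker t)

instance {X : Type*} [MeasurableSpace X] {d : ℕ} (ψ : Forecaster X d) (t : ℕ) :
    IsMarkovKernel (ψ.ker t) := ψ.isMarkov t

section UnbiasedPrediction

variable {X : Type*} [MeasurableSpace X] {d : ℕ} {𝓔 : Type*}

/-- `∑_{s < t} 𝔼_{p_s ∼ ψ_s}[E(π^{<s}, x_s, p_s) (p_s^i - y_s^i)]` along the transcript `h`. -/
def expectedBias (ψ : Forecaster X d) (E : Event X d) (i : Fin d) (t : ℕ)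
    (h : Transcript X d t) : ℝ :=
  ∑ s : Fin t, ∫ p, (E s (h.before s) (h s).1 p : ℝ) * ((p i : ℝ) - ((h s).2.2 i : ℝ))
    ∂(ψ.ker s (h.before s, (h s).1))

variable [Fintype 𝓔]

/-- The distribution `q_t` on triples `(E, i, σ)`, `σ = ±1`:
`q_t(E, i, σ) ∝ exp((η / 2) σ · expectedBias E i)`. -/
def weight (η : ℝ) (E : 𝓔 → Event X d) (ψ : Forecaster X d) (t : ℕ) (h : Transcript X d t)
    (k : 𝓔 × Fin d × ℤˣ) : ℝ :=
  Real.exp (η / 2 * (((k.2.2 : ℤ) : ℝ) * expectedBias ψ (E k.1) k.2.1 t h)) /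
    ∑ l : 𝓔 × Fin d × ℤˣ,
      Real.exp (η / 2 * (((l.2.2 : ℤ) : ℝ) * expectedBias ψ (E l.1) l.2.1 t h))

/-- The payoff of the minmax problem of round `t`, for a distribution `ν` over predictions and an
outcome `y`: `𝔼_{p ∼ ν}[∑_{E,i,σ} q_t(E,i,σ) · σ · E(π^{<t}, x_t, p) · (p^i - y^i)]`. -/
def payoff (η : ℝ) (E : 𝓔 → Event X d) (ψ : Forecaster X d) (t : ℕ) (h : Transcript X d t)
    (x : X) (ν : Measure (Cube d)) (y : Cube d) : ℝ :=
  ∫ p, ∑ k : 𝓔 × Fin d × ℤˣ, weight η E ψ t h k * ((k.2.2 : ℤ) : ℝ) *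
    (E k.1 t h x p : ℝ) * ((p k.2.1 : ℝ) - (y k.2.1 : ℝ)) ∂ν

/-- `ψ` runs Unbiased-Prediction for `T` rounds, with learning rate `η` and events `E`: in each
round its distribution solves the problem `min_ν max_y payoff ν y` up to the additive tolerance
`ε`. For `ε = 0` this says that it is an exact minimizer. -/
def IsUnbiasedPrediction (T : ℕ) (η ε : ℝ) (E : 𝓔 → Event X d) (ψ : Forecaster X d) : Prop :=
  ∀ t < T, ∀ (h : Transcript X d t) (x : X) (ν : Measure (Cube d)), IsProbabilityMeasure ν →
    ⨆ y, payoff η E ψ t h x (ψ.ker t (h, x)) y ≤ (⨆ y, payoff η E ψ t h x ν y) + ε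

end UnbiasedPrediction

open Classical in
/-- The events "the constrained best response of agent `n`, on its current candidate set, is `a`",
one for each agent `n` and action `a`. -/
def cbrEvents {X A N : Type*} [Fintype A] {d J : ℕ} (agent : N → Agent d J A)
    (cbr : N → Finset A → Cube d → A) (e : N × A) : Event X d :=
  fun t h _ p => if cbr e.1 (candidates (agent e.1) t h) p = e.2 then 1 else 0

/-! ### The interaction -/

/-- The realized transcript of the rounds before round `t`. -/
def transcript {Ω X : Type*} {d : ℕ} (x : ℕ → Ω → X) (p y : ℕ → Ω → Cube d) (t : ℕ) (ω : Ω) :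
    Transcript X d t :=
  fun s => (x s ω, p s ω, y s ω)

/-- The random features `x t`, predictions `p t` and outcomes `y t` are an interaction of the
forecaster `ψ` with some (randomized, adaptive) adversary over `T` rounds: in each round `t < T`,
conditionally on the transcript of the past rounds, on the feature `x t` and on the outcome `y t`,
the prediction `p t` has the law that `ψ` assigns to the transcript and the feature. That is, `p t`
is sampled from the forecaster's distribution, and the adversary's choice of `x t` and of `y t` may
depend on the past in any way, but not on the draw of `p t`. -/
structure IsInteraction {Ω X : Type*} [MeasurableSpace Ω] [MeasurableSpace X] {d : ℕ} (T : ℕ)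
    (ψ : Forecaster X d) (μ : Measure Ω) (x : ℕ → Ω → X) (p y : ℕ → Ω → Cube d) : Prop where
  measurable_x : ∀ t, Measurable (x t)
  measurable_p : ∀ t, Measurable (p t)
  measurable_y : ∀ t, Measurable (y t)
  law : ∀ t < T,
    μ.map (fun ω => (((transcript x p y t ω, x t ω), y t ω), p t ω)) =
      (μ.map (fun ω => ((transcript x p y t ω, x t ω), y t ω))) ⊗ₘ
        (Kernel.prodMkRight (Cube d) (ψ.ker t))

/-- The realized value of the event `E` in round `t`. -/
def realized {Ω X : Type*} {d : ℕ} (E : Event X d) (x : ℕ → Ω → X) (p y : ℕ → Ω → Cube d)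
    (t : ℕ) (ω : Ω) : ℝ :=
  E t (transcript x p y t ω) (x t ω) (p t ω)

end DecisionCalibration

end

/-!
Exponential weights on the triples `(E, i, σ)` give a stronger statement than required: all biases
are of order `√(T log (d |𝒜| |𝒩| / δ))`, uniformly over agents, actions and coordinates. The learning
rate is `2 √(log m / T)`, where `m = 2 d |𝒜| |𝒩|` is the number of triples. The exception is
`d |𝒜| |𝒩| = 1`, where `log m` is not controlled by `log (1 / δ)`. There the only action is played in
every round, and the second term of the bound takes over (`sqrt_mul_log_two_mul_div_le`).

*Minmax value.* In each round the value of the minmax problem is at most `0`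
(`exists_forall_integral_le`): against a randomized outcome with mean `ȳ` the prediction `ȳ` has
payoff `0`. The payoff is discontinuous in the prediction, so no minimax theorem with continuity
assumptions applies. But it is affine in the outcome, so only the vertices of the cube matter, and
the convex set of payoff vectors indexed by the vertices can be separated from an open orthant.

*Expected bias.* Hence the weighted average of the conditional biases of a round is at most the
tolerance `1 / T`, and the usual potential argument bounds every expected bias by a multiple of
`√(T log m)`, along every transcript (`IsUnbiasedPrediction.mul_abs_expectedBias_le`).

*Concentration.* The difference between the realized and the expected bias is a martingale with
bounded increments. The probability space is arbitrary, so conditional distributions need not exist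
in general. However, the law of the interaction comes disintegrated along the forecaster's kernels,
which is all that the proof of Azuma's inequality needs
(`IsInteraction.lintegral_exp_deviation_le`).

*Realizability.* The events depend on the transcript through finitely many candidate sets only, and
the worst-case payoff is Lipschitz in the weights. Rounding the weights leaves countably many minmax
problems, and a choice of one near-minimizer for each of them is a probability kernel
(`exists_kernel_near_minimizer`). The forecaster is then built round by round, since the weights of a
round depend on the earlier kernels only.
-/

noncomputable section

namespace DecisionCalibration

/-! ### Exponential weights -/

/-- One round of exponential weights: if the gains `g` have weighted average at most `v`, then
updating the weights multiplies their sum by at most `exp (a ^ 2 / 2 + v)`. -/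
lemma sum_weight_mul_exp_le {K : Type*} [Fintype K] {w g : K → ℝ} {a v : ℝ}
    (hw : ∀ k, 0 ≤ w k) (hg : ∀ k, |g k| ≤ 1) (ha : 0 ≤ a) (hv : 0 ≤ v)
    (h : ∑ k, w k * g k ≤ v * ∑ k, w k) :
    ∑ k, w k * Real.exp (a * g k) ≤ Real.exp (a ^ 2 / 2 + v) * ∑ k, w k := by
  have hW : 0 ≤ ∑ k, w k := sum_nonneg fun k _ => hw k
  calc ∑ k, w k * Real.exp (a * g k)
      ≤ ∑ k, w k * (Real.cosh a + g k * Real.sinh a) := by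
        refine sum_le_sum fun k _ => mul_le_mul_of_nonneg_left ?_ (hw k)
        rw [mul_comm a]
        exact Real.exp_mul_le_cosh_add_mul_sinh (hg k) a
    _ = Real.cosh a * ∑ k, w k + Real.sinh a * ∑ k, w k * g k := by
        rw [mul_sum, mul_sum, ← sum_add_distrib]
        exact sum_congr rfl fun k _ => by ring
    _ ≤ Real.cosh a * ∑ k, w k + Real.cosh a * (v * ∑ k, w k) := by
        have h1 := mul_le_mul_of_nonneg_left h (Real.sinh_nonneg_iff.2 ha)
        have h2 := mul_le_mul_of_nonneg_right (Real.sinh_lt_cosh (x := a)).le (mul_nonneg hv hW)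
        linarith
    _ = Real.cosh a * (v + 1) * ∑ k, w k := by ring
    _ ≤ Real.exp (a ^ 2 / 2) * Real.exp v * ∑ k, w k := by
        gcongr
        · exact Real.cosh_le_exp_half_sq a
        · exact Real.add_one_le_exp v
    _ = _ := by rw [Real.exp_add]

/-! ### Hoeffding's lemma -/

/-- Hoeffding's lemma for a variable with values in `[-1, 1]`, as a bound on a lower integral. -/
lemma lintegral_exp_sub_integral_le {α : Type*} [MeasurableSpace α] (μ : Measure α)
    [IsProbabilityMeasure μ] {f : α → ℝ} (hf : Measurable f) (hb : ∀ x, |f x| ≤ 1) (r : ℝ) :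
    ∫⁻ x, ENNReal.ofReal (Real.exp (r * (f x - ∫ z, f z ∂μ))) ∂μ
      ≤ ENNReal.ofReal (Real.exp (r ^ 2 / 2)) := by
  have h := hasSubgaussianMGF_of_mem_Icc (μ := μ) (a := -1) (b := 1) hf.aemeasurable
    (Filter.Eventually.of_forall fun x => abs_le.1 (hb x))
  rw [← ofReal_integral_eq_lintegral_ofReal (h.integrable_exp_mul r)
    (Filter.Eventually.of_forall fun x => (Real.exp_pos _).le)]
  refine ENNReal.ofReal_le_ofReal ((h.mgf_le r).trans_eq ?_)
  congr 1
  have : ‖(1 : ℝ) - -1‖ = 2 := by norm_num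
  push_cast
  rw [this]
  ring

/-! ### The minmax problem of one round -/

/-- The vertex of the cube whose coordinates are `1` on `Y` and `0` off `Y`. -/
def vertex {d : ℕ} (Y : Finset (Fin d)) : Cube d := fun i => if i ∈ Y then 1 else 0

lemma coe_vertex {d : ℕ} (Y : Finset (Fin d)) (i : Fin d) :
    (vertex Y i : ℝ) = if i ∈ Y then 1 else 0 := by
  unfold vertex; split_ifs <;> rfl

lemma measurable_coord {d : ℕ} (i : Fin d) : Measurable fun p : Cube d => (p i : ℝ) :=
  measurable_subtype_coe.comp (measurable_pi_apply i)

lemma abs_coord_sub_le {d : ℕ} (p y : Cube d) (i : Fin d) : |(p i : ℝ) - (y i : ℝ)| ≤ 1 := by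
  have h1 := (p i).2
  have h2 := (y i).2
  rw [abs_le]
  constructor <;> linarith [h1.1, h1.2, h2.1, h2.2]

lemma integrable_of_abs_le {α : Type*} [MeasurableSpace α] (μ : Measure α) [IsFiniteMeasure μ]
    {f : α → ℝ} (hf : Measurable f) {B : ℝ} (hb : ∀ x, |f x| ≤ B) : Integrable f μ :=
  .of_bound hf.aestronglyMeasurable B (Filter.Eventually.of_forall hb)

lemma integrable_mul_coord_sub {d : ℕ} (ν : Measure (Cube d)) [IsFiniteMeasure ν]
    {s : Cube d → ℝ} (hs : Measurable s) {B : ℝ} (hB : ∀ p, |s p| ≤ B) (i : Fin d) (c : Cube d) :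
    Integrable (fun p => s p * ((p i : ℝ) - (c i : ℝ))) ν := by
  refine integrable_of_abs_le ν (hs.mul ((measurable_coord i).sub_const _)) (B := B) fun p => ?_
  rw [abs_mul]
  nlinarith [abs_nonneg (s p), hB p, abs_coord_sub_le p c i]

/-- A payoff that is affine in the outcome is largest at a vertex of the cube. -/
lemma exists_vertex_integral_ge {d : ℕ} (ν : Measure (Cube d)) [IsProbabilityMeasure ν]
    {s : Fin d → Cube d → ℝ} (hs : ∀ i, Measurable (s i)) {B : ℝ} (hB : ∀ i p, |s i p| ≤ B)
    (y : Cube d) :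
    ∃ Y : Finset (Fin d), ∫ p, ∑ i, s i p * ((p i : ℝ) - (y i : ℝ)) ∂ν ≤
      ∫ p, ∑ i, s i p * ((p i : ℝ) - (vertex Y i : ℝ)) ∂ν := by
  classical
  refine ⟨univ.filter fun i => ∫ p, s i p ∂ν < 0, ?_⟩
  rw [integral_finsetSum _ fun i _ => integrable_mul_coord_sub ν (hs i) (hB i) i _,
    integral_finsetSum _ fun i _ => integrable_mul_coord_sub ν (hs i) (hB i) i _]
  refine sum_le_sum fun i _ => ?_
  rw [← sub_nonneg, ← integral_sub (integrable_mul_coord_sub ν (hs i) (hB i) i _)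
    (integrable_mul_coord_sub ν (hs i) (hB i) i _)]
  have : ∀ p : Cube d, s i p * ((p i : ℝ) - (vertex {i | ∫ p, s i p ∂ν < 0} i : ℝ))
      - s i p * ((p i : ℝ) - (y i : ℝ))
      = s i p * ((y i : ℝ) - (vertex {i | ∫ p, s i p ∂ν < 0} i : ℝ)) := fun p => by ring
  simp_rw [this]
  rw [integral_mul_const, coe_vertex]
  have hy := (y i).2
  split_ifs with h
  · have h' : ∫ p, s i p ∂ν < 0 := by simpa using h
    nlinarith [hy.2]
  · have h' : 0 ≤ ∫ p, s i p ∂ν := by simpa using h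
    nlinarith [hy.1]

/-- The value of the minmax problem is at most `0`, although the payoff may be discontinuous in the
prediction: against a randomized outcome with mean `ȳ`, predicting `ȳ` makes the expected payoff
vanish, and a separating hyperplane exchanges the order of play. -/
lemma exists_forall_integral_le {d : ℕ} {s : Fin d → Cube d → ℝ} (hs : ∀ i, Measurable (s i))
    {B : ℝ} (hB : ∀ i p, |s i p| ≤ B) {ε : ℝ} (hε : 0 < ε) :
    ∃ ν : Measure (Cube d), IsProbabilityMeasure ν ∧
      ∀ y : Cube d, ∫ p, ∑ i, s i p * ((p i : ℝ) - (y i : ℝ)) ∂ν ≤ ε := by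
  classical
  set u : Cube d → Cube d → ℝ := fun y p => ∑ i, s i p * ((p i : ℝ) - (y i : ℝ)) with hu
  have hint : ∀ (ν : Measure (Cube d)) [IsFiniteMeasure ν] (y : Cube d), Integrable (u y) ν :=
    fun ν _ y => integrable_finsetSum _ fun i _ => integrable_mul_coord_sub ν (hs i) (hB i) i _
  let S : Set (Finset (Fin d) → ℝ) :=
    {v | ∃ ν : Measure (Cube d), IsProbabilityMeasure ν ∧ ∀ Y, v Y = ∫ p, u (vertex Y) p ∂ν}
  let O : Set (Finset (Fin d) → ℝ) := Set.univ.pi fun _ => Set.Iio ε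
  have hS : Convex ℝ S := by
    rintro v ⟨ν, hν, hv⟩ w ⟨ρ, hρ, hw⟩ a b ha hb hab
    refine ⟨ENNReal.ofReal a • ν + ENNReal.ofReal b • ρ, ⟨?_⟩, fun Y => ?_⟩
    · simp [← ENNReal.ofReal_add ha hb, hab]
    · have i1 : Integrable (u (vertex Y)) (ENNReal.ofReal a • ν) :=
        (hint ν _).smul_measure ENNReal.ofReal_ne_top
      have i2 : Integrable (u (vertex Y)) (ENNReal.ofReal b • ρ) :=
        (hint ρ _).smul_measure ENNReal.ofReal_ne_top
      rw [integral_add_measure i1 i2, integral_smul_measure, integral_smul_measure,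
        ENNReal.toReal_ofReal ha, ENNReal.toReal_ofReal hb]
      simp [hv, hw]
  have hO : Convex ℝ O := convex_pi fun _ _ => convex_Iio ε
  have hOo : IsOpen O := isOpen_set_pi Set.finite_univ fun _ _ => isOpen_Iio
  by_cases hd : Disjoint O S
  · exfalso
    obtain ⟨f, c, hfO, hfS⟩ := geometric_hahn_banach_open hO hOo hS hd
    set ρ : Finset (Fin d) → ℝ := fun Y => f (Pi.single Y 1) with hρ
    have hf : ∀ v, f v = ∑ Y, v Y * ρ Y := by
      intro v
      conv_lhs => rw [← univ_sum_single v]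
      rw [map_sum]
      refine sum_congr rfl fun Y _ => ?_
      have : (Pi.single Y (v Y) : Finset (Fin d) → ℝ) = v Y • Pi.single Y 1 := by
        rw [← Pi.single_smul]; simp
      simp only [this, map_smul, smul_eq_mul, hρ]
    have h0 : 0 < c := by
      have := hfO 0 fun _ _ => hε
      rwa [map_zero] at this
    -- The orthant is unbounded in every negative direction, so the functional is nonnegative.
    have hρ0 : ∀ Y, 0 ≤ ρ Y := by
      intro Y
      by_contra hneg
      push Not at hneg
      have := hfO (Pi.single Y (c / ρ Y)) fun Z _ => by
        have h1 : c / ρ Y < 0 := div_neg_of_pos_of_neg h0 hneg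
        by_cases hZ : Z = Y
        · subst hZ; simp only [Pi.single_eq_same, Set.mem_Iio]; linarith
        · simpa [Pi.single_eq_of_ne hZ] using hε
      rw [hf] at this
      simp [Pi.single_apply, hneg.ne] at this
    have hkey : ∃ q : Cube d, ∀ i, ∑ Y, ρ Y * ((q i : ℝ) - (vertex Y i : ℝ)) = 0 := by
      have hm : ∀ i, 0 ≤ ∑ Y, ρ Y * (vertex Y i : ℝ) := fun i =>
        sum_nonneg fun Y _ => mul_nonneg (hρ0 Y) (vertex Y i).2.1
      have hm1 : ∀ i, ∑ Y, ρ Y * (vertex Y i : ℝ) ≤ ∑ Y, ρ Y := fun i =>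
        sum_le_sum fun Y _ => mul_le_of_le_one_right (hρ0 Y) (vertex Y i).2.2
      have hR : 0 ≤ ∑ Y, ρ Y := sum_nonneg fun Y _ => hρ0 Y
      refine ⟨fun i => ⟨(∑ Y, ρ Y * (vertex Y i : ℝ)) / ∑ Y, ρ Y,
        div_nonneg (hm i) hR, div_le_one_of_le₀ (hm1 i) hR⟩, fun i => ?_⟩
      simp only [mul_sub, sum_sub_distrib]
      rw [← sum_mul]
      rcases hR.eq_or_lt with h | h
      · have : ∑ Y, ρ Y * (vertex Y i : ℝ) = 0 := le_antisymm (h ▸ hm1 i) (hm i)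
        rw [this, ← h]; simp
      · rw [mul_div_cancel₀ _ h.ne', sub_self]
    obtain ⟨q, hq⟩ := hkey
    have h1 := hfS (fun Y => ∫ p, u (vertex Y) p ∂(Measure.dirac q))
      ⟨Measure.dirac q, inferInstance, fun Y => rfl⟩
    rw [hf] at h1
    simp only [integral_dirac] at h1
    have h2 : ∑ Y, u (vertex Y) q * ρ Y = 0 := by
      simp only [hu, sum_mul]
      rw [sum_comm]
      refine sum_eq_zero fun i _ => ?_
      have : ∀ Y, s i q * ((q i : ℝ) - (vertex Y i : ℝ)) * ρ Y
          = s i q * (ρ Y * ((q i : ℝ) - (vertex Y i : ℝ))) := fun Y => by ring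
      simp_rw [this]
      rw [← mul_sum, hq, mul_zero]
    linarith
  · obtain ⟨v, hvO, ν, hν, hv⟩ := Set.not_disjoint_iff.1 hd
    refine ⟨ν, hν, fun y => ?_⟩
    obtain ⟨Y, hY⟩ := exists_vertex_integral_ge ν hs hB y
    refine hY.trans ?_
    rw [← hv Y]
    exact (hvO Y trivial).le

section Game

variable {d : ℕ} {𝓔 : Type*} [Fintype 𝓔]

/-- The payoff of one round as a function of the weights `w` on the triples `(E, i, σ)` and of the
events `e`, the latter as functions of the prediction alone. -/
def gamePayoff (w : 𝓔 × Fin d × ℤˣ → ℝ) (e : 𝓔 → Cube d → unitInterval) (ν : Measure (Cube d))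
    (y : Cube d) : ℝ :=
  ∫ p, ∑ k : 𝓔 × Fin d × ℤˣ, w k * ((k.2.2 : ℤ) : ℝ) * (e k.1 p : ℝ) *
    ((p k.2.1 : ℝ) - (y k.2.1 : ℝ)) ∂ν

lemma abs_sign_eq_one (σ : ℤˣ) : |((σ : ℤ) : ℝ)| = 1 := by
  rcases Int.units_eq_one_or σ with rfl | rfl <;> simp

lemma abs_coe_unitInterval_le (a : unitInterval) : |(a : ℝ)| ≤ 1 :=
  abs_le.2 ⟨by linarith [a.2.1], a.2.2⟩

lemma abs_event_mul_le (a : unitInterval) (p y : Cube d) (i : Fin d) :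
    |(a : ℝ) * ((p i : ℝ) - (y i : ℝ))| ≤ 1 := by
  rw [abs_mul]
  exact mul_le_one₀ (abs_coe_unitInterval_le a) (abs_nonneg _) (abs_coord_sub_le p y i)

lemma abs_integral_event_mul_le (ν : Measure (Cube d)) [IsProbabilityMeasure ν]
    (e : Cube d → unitInterval) (y : Cube d) (i : Fin d) :
    |∫ p, (e p : ℝ) * ((p i : ℝ) - (y i : ℝ)) ∂ν| ≤ 1 := by
  have := norm_integral_le_of_norm_le_const (μ := ν) (C := 1)
    (f := fun p => (e p : ℝ) * ((p i : ℝ) - (y i : ℝ)))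
    (Filter.Eventually.of_forall fun p => abs_event_mul_le (e p) p y i)
  simpa using this

lemma gamePayoff_eq_sum (w : 𝓔 × Fin d × ℤˣ → ℝ) {e : 𝓔 → Cube d → unitInterval}
    (he : ∀ k, Measurable (e k)) (ν : Measure (Cube d)) [IsProbabilityMeasure ν] (y : Cube d) :
    gamePayoff w e ν y = ∑ k : 𝓔 × Fin d × ℤˣ, w k *
      (((k.2.2 : ℤ) : ℝ) * ∫ p, (e k.1 p : ℝ) * ((p k.2.1 : ℝ) - (y k.2.1 : ℝ)) ∂ν) := by
  have hi : ∀ k : 𝓔 × Fin d × ℤˣ,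
      Integrable (fun p => (e k.1 p : ℝ) * ((p k.2.1 : ℝ) - (y k.2.1 : ℝ))) ν := fun k =>
    integrable_mul_coord_sub ν (measurable_subtype_coe.comp (he k.1))
      (fun p => abs_coe_unitInterval_le (e k.1 p)) _ _
  unfold gamePayoff
  simp_rw [mul_assoc]
  rw [integral_finsetSum _ fun k _ => ((hi k).const_mul _).const_mul _]
  simp_rw [integral_const_mul]

lemma abs_gamePayoff_sub_le (w w' : 𝓔 × Fin d × ℤˣ → ℝ) {e : 𝓔 → Cube d → unitInterval}
    (he : ∀ k, Measurable (e k)) (ν : Measure (Cube d)) [IsProbabilityMeasure ν] (y : Cube d) :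
    |gamePayoff w e ν y - gamePayoff w' e ν y| ≤ ∑ k, |w k - w' k| := by
  rw [gamePayoff_eq_sum w he, gamePayoff_eq_sum w' he, ← sum_sub_distrib]
  refine (abs_sum_le_sum_abs _ _).trans (sum_le_sum fun k _ => ?_)
  rw [← sub_mul, abs_mul, abs_mul, abs_sign_eq_one, one_mul]
  exact mul_le_of_le_one_right (abs_nonneg _) (abs_integral_event_mul_le ν _ y _)

lemma abs_gamePayoff_le (w : 𝓔 × Fin d × ℤˣ → ℝ) {e : 𝓔 → Cube d → unitInterval}
    (he : ∀ k, Measurable (e k)) (ν : Measure (Cube d)) [IsProbabilityMeasure ν] (y : Cube d) :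
    |gamePayoff w e ν y| ≤ ∑ k, |w k| := by
  have := abs_gamePayoff_sub_le w 0 he ν y
  rw [gamePayoff_eq_sum 0 he] at this
  simpa using this

lemma bddAbove_gamePayoff (w : 𝓔 × Fin d × ℤˣ → ℝ) {e : 𝓔 → Cube d → unitInterval}
    (he : ∀ k, Measurable (e k)) (ν : Measure (Cube d)) [IsProbabilityMeasure ν] :
    BddAbove (Set.range (gamePayoff w e ν)) :=
  ⟨∑ k, |w k|, by rintro _ ⟨y, rfl⟩; exact (abs_le.1 (abs_gamePayoff_le w he ν y)).2⟩

/-- The worst-case payoff of a distribution depends on the weights in a Lipschitz way. -/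
lemma iSup_gamePayoff_le_add (w w' : 𝓔 × Fin d × ℤˣ → ℝ) {e : 𝓔 → Cube d → unitInterval}
    (he : ∀ k, Measurable (e k)) (ν : Measure (Cube d)) [IsProbabilityMeasure ν] :
    ⨆ y, gamePayoff w e ν y ≤ (⨆ y, gamePayoff w' e ν y) + ∑ k, |w k - w' k| := by
  refine ciSup_le fun y => ?_
  have h1 := (abs_le.1 (abs_gamePayoff_sub_le w w' he ν y)).2
  have h2 := le_ciSup (bddAbove_gamePayoff w' he ν) y
  linarith

lemma exists_forall_gamePayoff_le (w : 𝓔 × Fin d × ℤˣ → ℝ) {e : 𝓔 → Cube d → unitInterval}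
    (he : ∀ k, Measurable (e k)) {ε : ℝ} (hε : 0 < ε) :
    ∃ ν : Measure (Cube d), IsProbabilityMeasure ν ∧ ∀ y, gamePayoff w e ν y ≤ ε := by
  classical
  let b : 𝓔 × Fin d × ℤˣ → Cube d → ℝ := fun k p => w k * ((k.2.2 : ℤ) : ℝ) * (e k.1 p : ℝ)
  have hb : ∀ k, Measurable (b k) := fun k =>
    (measurable_subtype_coe.comp (he k.1)).const_mul _
  have hb' : ∀ k p, |b k p| ≤ |w k| := fun k p => by
    simp only [b]
    rw [abs_mul, abs_mul, abs_sign_eq_one, mul_one]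
    exact mul_le_of_le_one_right (abs_nonneg _) (abs_coe_unitInterval_le _)
  obtain ⟨ν, hν, h⟩ := exists_forall_integral_le
    (s := fun i p => ∑ k, if k.2.1 = i then b k p else 0) (B := ∑ k, |w k|) (ε := ε)
    (fun i => Finset.measurable_sum _ fun k _ => by
      split_ifs
      · exact hb k
      · exact measurable_const)
    (fun i p => (abs_sum_le_sum_abs _ _).trans <| sum_le_sum fun k _ => by
      split_ifs
      · exact hb' k p
      · simp) hε
  refine ⟨ν, hν, fun y => ?_⟩
  refine (h y).trans_eq' (integral_congr_ae (Filter.Eventually.of_forall fun p => ?_))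
  simp only [sum_mul]
  rw [sum_comm]
  refine sum_congr rfl fun k _ => ?_
  simp [ite_mul, b]

lemma exists_near_minimizer (w : 𝓔 × Fin d × ℤˣ → ℝ) {e : 𝓔 → Cube d → unitInterval}
    (he : ∀ k, Measurable (e k)) {ε : ℝ} (hε : 0 < ε) :
    ∃ ν : ProbabilityMeasure (Cube d), ∀ ρ : Measure (Cube d), IsProbabilityMeasure ρ →
      ⨆ y, gamePayoff w e ν y ≤ (⨆ y, gamePayoff w e ρ y) + ε := by
  have : Nonempty (ProbabilityMeasure (Cube d)) := ⟨⟨Measure.dirac 0, inferInstance⟩⟩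
  obtain ⟨ν, hν⟩ := exists_lt_of_ciInf_lt (lt_add_of_pos_right
    (⨅ ν : ProbabilityMeasure (Cube d), ⨆ y, gamePayoff w e ν y) hε)
  refine ⟨ν, fun ρ hρ => hν.le.trans (add_le_add_left (ciInf_le ?_ (⟨ρ, hρ⟩ :
    ProbabilityMeasure (Cube d))) ε)⟩
  refine ⟨-∑ k, |w k|, ?_⟩
  rintro _ ⟨ν', rfl⟩
  have := ν'.2
  exact (abs_le.1 (abs_gamePayoff_le w he ν'.1 0)).1.trans
    (le_ciSup (bddAbove_gamePayoff w he ν'.1) 0)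

end Game

/-! ### Measurability along the transcript -/

section Measurability

variable {X : Type*} [MeasurableSpace X] {d : ℕ}

/-- An event is measurable if, in every round, its value is a jointly measurable function of the
transcript, the feature and the prediction. -/
def IsMeasurableEvent (E : Event X d) : Prop :=
  ∀ t, Measurable fun z : (Transcript X d t × X) × Cube d => E t z.1.1 z.1.2 z.2

lemma IsMeasurableEvent.prediction {E : Event X d} (hE : IsMeasurableEvent E) (t : ℕ)
    (h : Transcript X d t) (x : X) : Measurable (E t h x) :=
  (hE t).comp (measurable_prodMk_left (x := (h, x)))

lemma measurable_init (t : ℕ) :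
    Measurable (Fin.init : Transcript X d (t + 1) → Transcript X d t) :=
  measurable_pi_lambda _ fun s => measurable_pi_apply s.castSucc

lemma measurable_last (t : ℕ) :
    Measurable fun h : Transcript X d (t + 1) => h (Fin.last t) :=
  measurable_pi_apply _

/-- The conditional expectation, given the past and the outcome, of the bias incurred in one
round. -/
def roundBias (ψ : Forecaster X d) (E : Event X d) (i : Fin d) (t : ℕ) (h : Transcript X d t)
    (x : X) (y : Cube d) : ℝ :=
  ∫ p, (E t h x p : ℝ) * ((p i : ℝ) - (y i : ℝ)) ∂(ψ.ker t (h, x))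

lemma abs_roundBias_le (ψ : Forecaster X d) (E : Event X d) (i : Fin d) (t : ℕ)
    (h : Transcript X d t) (x : X) (y : Cube d) : |roundBias ψ E i t h x y| ≤ 1 :=
  abs_integral_event_mul_le _ _ _ _

lemma measurable_event_mul {E : Event X d} (hE : IsMeasurableEvent E) (i : Fin d) (t : ℕ) :
    Measurable fun z : ((Transcript X d t × X) × Cube d) × Cube d =>
      (E t z.1.1.1 z.1.1.2 z.2 : ℝ) * ((z.2 i : ℝ) - (z.1.2 i : ℝ)) := by
  refine Measurable.mul ?_ (((measurable_coord i).comp measurable_snd).sub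
    ((measurable_coord i).comp measurable_fst.snd))
  exact measurable_subtype_coe.comp
    ((hE t).comp (measurable_fst.fst.prodMk measurable_snd))

lemma measurable_roundBias (ψ : Forecaster X d) {E : Event X d} (hE : IsMeasurableEvent E)
    (i : Fin d) (t : ℕ) :
    Measurable fun z : (Transcript X d t × X) × Cube d => roundBias ψ E i t z.1.1 z.1.2 z.2 :=
  ((measurable_event_mul hE i t).stronglyMeasurable.integral_kernel_prod_right'
    (κ := Kernel.prodMkRight (Cube d) (ψ.ker t))).measurable

lemma expectedBias_succ (ψ : Forecaster X d) (E : Event X d) (i : Fin d) (t : ℕ)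
    (h : Transcript X d (t + 1)) :
    expectedBias ψ E i (t + 1) h = expectedBias ψ E i t (Fin.init h) +
      roundBias ψ E i t (Fin.init h) (h (Fin.last t)).1 (h (Fin.last t)).2.2 := by
  unfold expectedBias
  rw [Fin.sum_univ_castSucc]
  rfl

lemma expectedBias_zero (ψ : Forecaster X d) (E : Event X d) (i : Fin d)
    (h : Transcript X d 0) : expectedBias ψ E i 0 h = 0 := by
  simp [expectedBias]

lemma measurable_expectedBias (ψ : Forecaster X d) {E : Event X d} (hE : IsMeasurableEvent E)
    (i : Fin d) (t : ℕ) : Measurable (expectedBias ψ E i t) := by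
  induction t with
  | zero => simpa only [funext (expectedBias_zero ψ E i)] using measurable_const
  | succ t ih =>
    simp_rw [funext (expectedBias_succ ψ E i t)]
    exact (ih.comp (measurable_init t)).add ((measurable_roundBias ψ hE i t).comp
      (((measurable_init t).prodMk (measurable_last t).fst).prodMk (measurable_last t).snd.snd))

variable {𝓔 : Type*} [Fintype 𝓔]

lemma measurable_weight (η : ℝ) {E : 𝓔 → Event X d} (hE : ∀ k, IsMeasurableEvent (E k))
    (ψ : Forecaster X d) (t : ℕ) (k : 𝓔 × Fin d × ℤˣ) :
    Measurable fun h => weight η E ψ t h k := by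
  have : ∀ l : 𝓔 × Fin d × ℤˣ, Measurable fun h : Transcript X d t =>
      Real.exp (η / 2 * (((l.2.2 : ℤ) : ℝ) * expectedBias ψ (E l.1) l.2.1 t h)) := fun l =>
    (((measurable_expectedBias ψ (hE l.1) l.2.1 t).const_mul _).const_mul _).exp
  exact (this k).div (Finset.measurable_sum _ fun l _ => this l)

lemma weight_nonneg (η : ℝ) (E : 𝓔 → Event X d) (ψ : Forecaster X d) (t : ℕ)
    (h : Transcript X d t) (k : 𝓔 × Fin d × ℤˣ) : 0 ≤ weight η E ψ t h k :=
  div_nonneg (Real.exp_pos _).le (sum_nonneg fun _ _ => (Real.exp_pos _).le)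

/-- The weights of round `t` depend on the forecaster's distributions in earlier rounds only. -/
lemma weight_congr (η : ℝ) (E : 𝓔 → Event X d) {ψ φ : Forecaster X d} {t : ℕ}
    (hψ : ∀ s < t, ψ.ker s = φ.ker s) (h : Transcript X d t) :
    weight η E ψ t h = weight η E φ t h := by
  have : ∀ k i, expectedBias ψ (E k) i t h = expectedBias φ (E k) i t h := fun k i =>
    sum_congr rfl fun s _ => by rw [hψ s s.2]
  funext k
  simp only [weight, this]

lemma payoff_eq_gamePayoff (η : ℝ) (E : 𝓔 → Event X d) (ψ : Forecaster X d) (t : ℕ)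
    (h : Transcript X d t) (x : X) :
    payoff η E ψ t h x = gamePayoff (weight η E ψ t h) fun k => E k t h x := rfl

end Measurability

/-! ### Realizing the algorithm by probability kernels -/

section Realization

variable {X : Type*} [MeasurableSpace X] {d : ℕ} {𝓔 : Type*} [Fintype 𝓔]

/-- The forecaster that uses `κ` in round `t` and agrees with `ψ` in all other rounds. -/
def Forecaster.update (ψ : Forecaster X d) (t : ℕ) (κ : Kernel (Transcript X d t × X) (Cube d))
    (hκ : IsMarkovKernel κ) : Forecaster X d where
  ker := Function.update ψ.ker t κ
  isMarkov s := by
    rcases eq_or_ne s t with rfl | h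
    · rwa [Function.update_self]
    · rw [Function.update_of_ne h]
      exact ψ.isMarkov s

lemma abs_sub_floor_div_le {m w : ℝ} (hm : 0 < m) (hw : 0 ≤ w) :
    |w - (⌊m * w⌋₊ : ℝ) / m| ≤ 1 / m := by
  have h1 := Nat.floor_le (mul_nonneg hm.le hw)
  have h2 := Nat.lt_floor_add_one (m * w)
  have h3 : w - (⌊m * w⌋₊ : ℝ) / m = (m * w - ⌊m * w⌋₊) / m := by field_simp
  rw [h3, abs_of_nonneg (div_nonneg (by linarith) hm.le)]
  gcongr
  linarith

/-- Near-minimizers can be selected measurably in the weights and in a countable parameter on which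
the events depend: round the weights to a countable set and fix a near-minimizer for each rounded
value. -/
lemma exists_kernel_near_minimizer {α ι : Type*} [MeasurableSpace α] [Countable ι]
    [MeasurableSpace ι] [MeasurableSingletonClass ι] {F : 𝓔 → ι → Cube d → unitInterval}
    (hF : ∀ k i, Measurable (F k i)) {w : α → 𝓔 × Fin d × ℤˣ → ℝ}
    (hw : ∀ k, Measurable fun a => w a k) (hw0 : ∀ a k, 0 ≤ w a k) {c : α → ι}
    (hc : Measurable c) {ε : ℝ} (hε : 0 < ε) :
    ∃ κ : Kernel α (Cube d), IsMarkovKernel κ ∧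
      ∀ (a : α) (ν : Measure (Cube d)), IsProbabilityMeasure ν →
        ⨆ y, gamePayoff (w a) (fun k => F k (c a)) (κ a) y
          ≤ (⨆ y, gamePayoff (w a) (fun k => F k (c a)) ν y) + ε := by
  set n : ℝ := ((Fintype.card (𝓔 × Fin d × ℤˣ) : ℕ) : ℝ) with hn
  have hn0 : 0 ≤ n := Nat.cast_nonneg _
  -- With precision `1 / m`, rounding costs `n / m ≤ ε / 4` on either side of the comparison.
  set m : ℝ := (4 * n + 1) / ε with hm
  have hm0 : 0 < m := by positivity
  choose κ₀ hκ₀ using fun z : (𝓔 × Fin d × ℤˣ → ℕ) × ι =>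
    exists_near_minimizer (fun k => (z.1 k : ℝ) / m) (e := fun k => F k z.2)
      (fun k => hF k z.2) (half_pos hε)
  let r : α → (𝓔 × Fin d × ℤˣ → ℕ) × ι := fun a => (fun k => ⌊m * w a k⌋₊, c a)
  have hr : Measurable r := by
    refine Measurable.prodMk (measurable_pi_lambda _ fun k => ?_) hc
    exact Nat.measurable_floor.comp ((hw k).const_mul m)
  let κ : Kernel α (Cube d) :=
    (Kernel.ofFunOfCountable fun z => (κ₀ z : Measure (Cube d))).comap r hr
  have hκ : ∀ a, κ a = κ₀ (r a) := fun a => rfl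
  refine ⟨κ, ⟨fun a => by rw [hκ]; infer_instance⟩, fun a ν hν => ?_⟩
  rw [hκ]
  have hround : ∑ k, |w a k - ((r a).1 k : ℝ) / m| ≤ ε / 4 := by
    calc ∑ k, |w a k - ((r a).1 k : ℝ) / m| ≤ ∑ _k : 𝓔 × Fin d × ℤˣ, 1 / m :=
          sum_le_sum fun k _ => abs_sub_floor_div_le hm0 (hw0 a k)
      _ = n / m := by rw [sum_const, card_univ, nsmul_eq_mul, ← hn]; ring
      _ ≤ ε / 4 := by
          rw [div_le_iff₀ hm0, hm]
          have : ε / 4 * ((4 * n + 1) / ε) = n + 1 / 4 := by field_simp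
          linarith
  have h1 := iSup_gamePayoff_le_add (w a) (fun k => ((r a).1 k : ℝ) / m)
    (e := fun k => F k (c a)) (fun k => hF k _) (κ₀ (r a))
  have h2 := iSup_gamePayoff_le_add (fun k => ((r a).1 k : ℝ) / m) (w a)
    (e := fun k => F k (c a)) (fun k => hF k _) ν
  have h3 := hκ₀ (r a) ν hν
  simp_rw [abs_sub_comm _ (w a _)] at h2
  change _ ≤ (⨆ y, gamePayoff _ (fun k => F k (c a)) ν y) + _ at h3
  change ⨆ y, gamePayoff _ (fun k => F k (c a)) _ y ≤ _ at h3
  linarith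

lemma exists_isUnbiasedPrediction {ι : Type*} [Countable ι] [MeasurableSpace ι]
    [MeasurableSingletonClass ι] {E : 𝓔 → Event X d} (hE : ∀ k, IsMeasurableEvent (E k))
    {F : 𝓔 → ι → Cube d → unitInterval} (hF : ∀ k i, Measurable (F k i))
    {c : ∀ t, Transcript X d t → ι} (hc : ∀ t, Measurable (c t))
    (hEF : ∀ k t h x p, E k t h x p = F k (c t h) p) (η : ℝ) {ε : ℝ} (hε : 0 < ε) (T : ℕ) :
    ∃ ψ : Forecaster X d, IsUnbiasedPrediction T η ε E ψ := by
  induction T with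
  | zero =>
    exact ⟨⟨fun _ => Kernel.const _ (Measure.dirac 0), fun _ => inferInstance⟩,
      fun t ht => absurd ht (Nat.not_lt_zero t)⟩
  | succ T ih =>
    obtain ⟨ψ, hψ⟩ := ih
    obtain ⟨κ, hκ, hmin⟩ := exists_kernel_near_minimizer (α := Transcript X d T × X) hF
      (w := fun z => weight η E ψ T z.1) (fun k => (measurable_weight η hE ψ T k).comp measurable_fst)
      (fun z => weight_nonneg η E ψ T z.1) ((hc T).comp measurable_fst) hε
    have hlt : ∀ s < T, (ψ.update T κ hκ).ker s = ψ.ker s := fun s hs =>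
      Function.update_of_ne hs.ne _ _
    refine ⟨ψ.update T κ hκ, fun t ht h x ν hν => ?_⟩
    have hw : weight η E (ψ.update T κ hκ) t h = weight η E ψ t h :=
      weight_congr η E (fun s hs => hlt s (hs.trans_le (Nat.lt_succ_iff.1 ht))) h
    rw [payoff_eq_gamePayoff, hw]
    rcases (Nat.lt_succ_iff.1 ht).lt_or_eq with h' | rfl
    · rw [hlt t h']
      exact hψ t h' h x ν hν
    · have hker : (ψ.update t κ hκ).ker t = κ := Function.update_self _ _ _
      have hEF' : (fun k => E k t h x) = fun k => F k (c t h) :=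
        funext fun k => funext fun p => hEF k t h x p
      rw [hker, hEF']
      exact hmin (h, x) ν hν

end Realization

/-! ### The expected bias of the algorithm -/

section Bias

variable {X : Type*} [MeasurableSpace X] {d : ℕ} {𝓔 : Type*} [Fintype 𝓔]

/-- In a round of the algorithm, the weighted average of the conditional biases is at most the
tolerance, since the minmax value is at most `0`. -/
lemma IsUnbiasedPrediction.sum_weight_mul_roundBias_le {T : ℕ} {η ε : ℝ} {E : 𝓔 → Event X d}
    (hE : ∀ k, IsMeasurableEvent (E k)) {ψ : Forecaster X d}
    (hψ : IsUnbiasedPrediction T η ε E ψ) {t : ℕ} (ht : t < T) (h : Transcript X d t) (x : X)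
    (y : Cube d) :
    ∑ k : 𝓔 × Fin d × ℤˣ, weight η E ψ t h k *
      (((k.2.2 : ℤ) : ℝ) * roundBias ψ (E k.1) k.2.1 t h x y) ≤ ε := by
  have he : ∀ k, Measurable (E k t h x) := fun k => (hE k).prediction t h x
  refine le_of_forall_pos_le_add fun ε' hε' => ?_
  obtain ⟨ν, hν, hle⟩ := exists_forall_gamePayoff_le (weight η E ψ t h) he hε'
  calc _ = payoff η E ψ t h x (ψ.ker t (h, x)) y := by
        rw [payoff_eq_gamePayoff, gamePayoff_eq_sum _ he]
        rfl
    _ ≤ ⨆ y, payoff η E ψ t h x (ψ.ker t (h, x)) y :=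
        le_ciSup (bddAbove_gamePayoff (weight η E ψ t h) he (ψ.ker t (h, x))) y
    _ ≤ (⨆ y, payoff η E ψ t h x ν y) + ε := hψ t ht h x ν hν
    _ ≤ ε' + ε := by
        gcongr
        exact ciSup_le hle
    _ = ε + ε' := add_comm _ _

/-- The potential argument for exponential weights, along an arbitrary transcript. -/
lemma IsUnbiasedPrediction.sum_exp_le {T : ℕ} {a ε : ℝ} (ha : 0 ≤ a) (hε : 0 ≤ ε)
    {E : 𝓔 → Event X d} (hE : ∀ k, IsMeasurableEvent (E k)) {ψ : Forecaster X d}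
    (hψ : IsUnbiasedPrediction T (2 * a) ε E ψ) {t : ℕ} (ht : t ≤ T) (h : Transcript X d t) :
    ∑ k : 𝓔 × Fin d × ℤˣ,
        Real.exp (a * (((k.2.2 : ℤ) : ℝ) * expectedBias ψ (E k.1) k.2.1 t h)) ≤
      Fintype.card (𝓔 × Fin d × ℤˣ) * Real.exp (t * (a ^ 2 / 2 + ε)) := by
  induction t with
  | zero => simp [expectedBias_zero]
  | succ t ih =>
    set x := (h (Fin.last t)).1
    set y := (h (Fin.last t)).2.2
    set W : 𝓔 × Fin d × ℤˣ → ℝ := fun k =>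
      Real.exp (a * (((k.2.2 : ℤ) : ℝ) * expectedBias ψ (E k.1) k.2.1 t (Fin.init h))) with hW
    have hW0 : ∀ k, 0 ≤ W k := fun k => (Real.exp_pos _).le
    have hweight : ∀ k, weight (2 * a) E ψ t (Fin.init h) k = W k / ∑ l, W l := fun k => by
      simp only [weight, mul_div_cancel_left₀ a (two_ne_zero' ℝ), hW]
    have hbias := hψ.sum_weight_mul_roundBias_le hE (t := t) (by lia) (Fin.init h) x y
    have hstep : ∑ k, W k * (((k.2.2 : ℤ) : ℝ) * roundBias ψ (E k.1) k.2.1 t (Fin.init h) x y)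
        ≤ ε * ∑ k, W k := by
      rcases (sum_nonneg fun k _ => hW0 k).eq_or_lt with h0 | hpos
      · have hk : ∀ k, W k = 0 := fun k =>
          (sum_eq_zero_iff_of_nonneg fun k _ => hW0 k).1 h0.symm k (mem_univ k)
        simp [hk]
      · rw [← div_le_iff₀ hpos, sum_div]
        refine le_trans (le_of_eq (sum_congr rfl fun k _ => ?_)) hbias
        rw [hweight]
        ring
    calc _ = ∑ k, W k * Real.exp (a *
          (((k.2.2 : ℤ) : ℝ) * roundBias ψ (E k.1) k.2.1 t (Fin.init h) x y)) := by
          refine sum_congr rfl fun k _ => ?_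
          rw [hW, ← Real.exp_add, expectedBias_succ]
          congr 1
          ring
      _ ≤ Real.exp (a ^ 2 / 2 + ε) * ∑ k, W k := by
          refine sum_weight_mul_exp_le hW0 (fun k => ?_) ha hε hstep
          rw [abs_mul, abs_sign_eq_one, one_mul]
          exact abs_roundBias_le _ _ _ _ _ _ _
      _ ≤ Real.exp (a ^ 2 / 2 + ε) * (Fintype.card (𝓔 × Fin d × ℤˣ) *
            Real.exp (t * (a ^ 2 / 2 + ε))) := by
          gcongr
          exact ih (by lia) _
      _ = _ := by
          rw [mul_left_comm, ← Real.exp_add]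
          push_cast
          ring_nf

lemma IsUnbiasedPrediction.mul_abs_expectedBias_le {T : ℕ} {a ε : ℝ} (ha : 0 ≤ a) (hε : 0 ≤ ε)
    {E : 𝓔 → Event X d} (hE : ∀ k, IsMeasurableEvent (E k)) {ψ : Forecaster X d}
    (hψ : IsUnbiasedPrediction T (2 * a) ε E ψ) (h : Transcript X d T) (e : 𝓔) (i : Fin d) :
    a * |expectedBias ψ (E e) i T h| ≤
      Real.log (Fintype.card (𝓔 × Fin d × ℤˣ)) + T * (a ^ 2 / 2 + ε) := by
  have hcard : (0 : ℝ) < Fintype.card (𝓔 × Fin d × ℤˣ) :=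
    Nat.cast_pos.2 (Fintype.card_pos_iff.2 ⟨(e, i, 1)⟩)
  have hsign : ∀ σ : ℤˣ, a * (((σ : ℤ) : ℝ) * expectedBias ψ (E e) i T h) ≤
      Real.log (Fintype.card (𝓔 × Fin d × ℤˣ)) + T * (a ^ 2 / 2 + ε) := fun σ => by
    rw [← Real.exp_le_exp, Real.exp_add, Real.exp_log hcard]
    exact (single_le_sum (f := fun k : 𝓔 × Fin d × ℤˣ =>
      Real.exp (a * (((k.2.2 : ℤ) : ℝ) * expectedBias ψ (E k.1) k.2.1 T h)))
      (fun _ _ => (Real.exp_pos _).le) (mem_univ (e, i, σ))).trans (hψ.sum_exp_le ha hε hE le_rfl h)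
  rcases abs_cases (expectedBias ψ (E e) i T h) with ⟨h1, -⟩ | ⟨h1, -⟩
  · simpa [h1] using hsign 1
  · simpa [h1] using hsign (-1)

end Bias

/-! ### Concentration of the realized bias -/

section Concentration

variable {X : Type*} [MeasurableSpace X] {d : ℕ}

/-- The realized bias minus the expected bias along a transcript: a martingale in the number of
rounds when the transcript comes from an interaction. -/
def deviation (ψ : Forecaster X d) (E : Event X d) (i : Fin d) (t : ℕ)
    (h : Transcript X d t) : ℝ :=
  (∑ s : Fin t, (E s (h.before s) (h s).1 (h s).2.1 : ℝ) *
    (((h s).2.1 i : ℝ) - ((h s).2.2 i : ℝ))) - expectedBias ψ E i t h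

lemma deviation_succ (ψ : Forecaster X d) (E : Event X d) (i : Fin d) (t : ℕ)
    (h : Transcript X d (t + 1)) :
    deviation ψ E i (t + 1) h = deviation ψ E i t (Fin.init h) +
      ((E t (Fin.init h) (h (Fin.last t)).1 (h (Fin.last t)).2.1 : ℝ) *
          (((h (Fin.last t)).2.1 i : ℝ) - ((h (Fin.last t)).2.2 i : ℝ)) -
        roundBias ψ E i t (Fin.init h) (h (Fin.last t)).1 (h (Fin.last t)).2.2) := by
  unfold deviation
  rw [expectedBias_succ, Fin.sum_univ_castSucc, add_sub_add_comm]
  rfl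

lemma measurable_deviation (ψ : Forecaster X d) {E : Event X d} (hE : IsMeasurableEvent E)
    (i : Fin d) (t : ℕ) : Measurable (deviation ψ E i t) := by
  induction t with
  | zero =>
    have : deviation ψ E i 0 = fun _ => 0 := funext fun h => by simp [deviation, expectedBias_zero]
    exact this ▸ measurable_const
  | succ t ih =>
    simp_rw [funext (deviation_succ ψ E i t)]
    have hz : Measurable fun h : Transcript X d (t + 1) =>
        ((Fin.init h, (h (Fin.last t)).1), (h (Fin.last t)).2.2) :=
      ((measurable_init t).prodMk (measurable_last t).fst).prodMk (measurable_last t).snd.snd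
    exact (ih.comp (measurable_init t)).add
      (((measurable_event_mul hE i t).comp (hz.prodMk (measurable_last t).snd.fst)).sub
        ((measurable_roundBias ψ hE i t).comp hz))

lemma deviation_transcript {Ω : Type*} (ψ : Forecaster X d) (E : Event X d) (i : Fin d) (T : ℕ)
    (x : ℕ → Ω → X) (p y : ℕ → Ω → Cube d) (ω : Ω) :
    deviation ψ E i T (transcript x p y T ω) =
      ∑ t ∈ range T, realized E x p y t ω * ((p t ω i : ℝ) - (y t ω i : ℝ)) -
        expectedBias ψ E i T (transcript x p y T ω) := by
  rw [deviation, ← Fin.sum_univ_eq_sum_range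
    (fun t => realized E x p y t ω * ((p t ω i : ℝ) - (y t ω i : ℝ))) T]
  rfl

variable {Ω : Type*} [MeasurableSpace Ω] {T : ℕ} {ψ : Forecaster X d}
  {μ : Measure Ω} {x : ℕ → Ω → X} {p y : ℕ → Ω → Cube d}

lemma IsInteraction.measurable_transcript (hI : IsInteraction T ψ μ x p y) (t : ℕ) :
    Measurable (transcript x p y t) :=
  measurable_pi_lambda _ fun s =>
    (hI.measurable_x s).prodMk ((hI.measurable_p s).prodMk (hI.measurable_y s))

/-- Azuma's bound on the exponential moments. The conditioning uses the disintegration built into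
the law of the interaction, so that no regularity of the underlying probability space is needed. -/
lemma IsInteraction.lintegral_exp_deviation_le [IsProbabilityMeasure μ]
    (hI : IsInteraction T ψ μ x p y) {E : Event X d} (hE : IsMeasurableEvent E) (i : Fin d)
    (r : ℝ) {t : ℕ} (ht : t ≤ T) :
    ∫⁻ ω, ENNReal.ofReal (Real.exp (r * deviation ψ E i t (transcript x p y t ω))) ∂μ
      ≤ ENNReal.ofReal (Real.exp (t * (r ^ 2 / 2))) := by
  induction t with
  | zero => simp [deviation, expectedBias_zero]
  | succ t ih =>
    set past : Ω → (Transcript X d t × X) × Cube d :=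
      fun ω => ((transcript x p y t ω, x t ω), y t ω) with hpast
    have hpast_meas : Measurable past :=
      ((hI.measurable_transcript t).prodMk (hI.measurable_x t)).prodMk (hI.measurable_y t)
    set D : (Transcript X d t × X) × Cube d → ENNReal :=
      fun z => ENNReal.ofReal (Real.exp (r * deviation ψ E i t z.1.1)) with hD
    have hD_meas : Measurable D := by
      have := (measurable_deviation ψ hE i t).comp
        (measurable_fst.fst : Measurable fun z : (Transcript X d t × X) × Cube d => z.1.1)
      exact (this.const_mul r).exp.ennreal_ofReal
    set G : ((Transcript X d t × X) × Cube d) × Cube d → ENNReal := fun z =>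
      ENNReal.ofReal (Real.exp (r * ((E t z.1.1.1 z.1.1.2 z.2 : ℝ) *
        ((z.2 i : ℝ) - (z.1.2 i : ℝ)) - roundBias ψ E i t z.1.1.1 z.1.1.2 z.1.2))) with hG
    have hG_meas : Measurable G :=
      (((measurable_event_mul hE i t).sub
        ((measurable_roundBias ψ hE i t).comp measurable_fst)).const_mul r).exp.ennreal_ofReal
    have hDG : Measurable fun z : ((Transcript X d t × X) × Cube d) × Cube d => D z.1 * G z :=
      (hD_meas.comp measurable_fst).mul hG_meas
    have hinner : ∀ z, ∫⁻ q, G (z, q) ∂(ψ.ker t z.1) ≤ ENNReal.ofReal (Real.exp (r ^ 2 / 2)) :=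
      fun z => lintegral_exp_sub_integral_le (ψ.ker t z.1)
        (f := fun q => (E t z.1.1 z.1.2 q : ℝ) * ((q i : ℝ) - (z.2 i : ℝ)))
        ((measurable_event_mul hE i t).comp (measurable_prodMk_left (x := z)))
        (fun q => abs_event_mul_le _ _ _ _) r
    calc _ = ∫⁻ ω, D (past ω) * G (past ω, p t ω) ∂μ := by
          refine lintegral_congr fun ω => ?_
          rw [hD, hG, ← ENNReal.ofReal_mul (Real.exp_pos _).le, ← Real.exp_add, deviation_succ,
            mul_add]
          rfl
      _ = ∫⁻ z, D z.1 * G z ∂(μ.map fun ω => (past ω, p t ω)) :=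
          (lintegral_map hDG (hpast_meas.prodMk (hI.measurable_p t))).symm
      _ = ∫⁻ z, D z * ∫⁻ q, G (z, q) ∂(ψ.ker t z.1) ∂(μ.map past) := by
          have := Measure.isProbabilityMeasure_map (μ := μ) hpast_meas.aemeasurable
          rw [hI.law t (by lia), Measure.lintegral_compProd hDG]
          refine lintegral_congr fun z => ?_
          rw [Kernel.prodMkRight_apply]
          exact lintegral_const_mul (D z) (f := fun q => G (z, q))
            (hG_meas.comp (measurable_prodMk_left (x := z)))
      _ ≤ ∫⁻ z, D z * ENNReal.ofReal (Real.exp (r ^ 2 / 2)) ∂(μ.map past) := by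
          gcongr with z
          exact hinner z
      _ = (∫⁻ ω, D (past ω) ∂μ) * ENNReal.ofReal (Real.exp (r ^ 2 / 2)) := by
          rw [lintegral_mul_const _ hD_meas, lintegral_map hD_meas hpast_meas]
      _ ≤ ENNReal.ofReal (Real.exp (t * (r ^ 2 / 2))) * ENNReal.ofReal (Real.exp (r ^ 2 / 2)) := by
          gcongr
          exact ih (by lia)
      _ = _ := by
          rw [← ENNReal.ofReal_mul (Real.exp_pos _).le, ← Real.exp_add]
          push_cast
          ring_nf

lemma IsInteraction.measure_le_sign_mul_deviation_le [IsProbabilityMeasure μ]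
    (hI : IsInteraction T ψ μ x p y) (hT : 0 < T) {E : Event X d} (hE : IsMeasurableEvent E)
    (i : Fin d) (σ : ℤˣ) {s : ℝ} (hs : 0 ≤ s) :
    μ {ω | s ≤ ((σ : ℤ) : ℝ) * deviation ψ E i T (transcript x p y T ω)} ≤
      ENNReal.ofReal (Real.exp (-(s ^ 2 / (2 * T)))) := by
  have hT' : (0 : ℝ) < T := Nat.cast_pos.2 hT
  have hσ : ((σ : ℤ) : ℝ) ^ 2 = 1 := by rw [← sq_abs, abs_sign_eq_one, one_pow]
  -- `s / T` minimizes the exponent `T * r ^ 2 / 2 - r * s`.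
  set r : ℝ := s / T * ((σ : ℤ) : ℝ) with hr
  have hmeas : Measurable fun ω =>
      ENNReal.ofReal (Real.exp (r * deviation ψ E i T (transcript x p y T ω))) :=
    (((measurable_deviation ψ hE i T).comp
      (hI.measurable_transcript T)).const_mul r).exp.ennreal_ofReal
  have hpos : 0 < ENNReal.ofReal (Real.exp (s / T * s)) := ENNReal.ofReal_pos.2 (Real.exp_pos _)
  calc _ ≤ μ {ω | ENNReal.ofReal (Real.exp (s / T * s)) ≤
          ENNReal.ofReal (Real.exp (r * deviation ψ E i T (transcript x p y T ω)))} := by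
        refine measure_mono fun ω hω => ?_
        refine ENNReal.ofReal_le_ofReal (Real.exp_le_exp.2 ?_)
        rw [hr, mul_assoc]
        exact mul_le_mul_of_nonneg_left hω (div_nonneg hs hT'.le)
    _ ≤ (∫⁻ ω, ENNReal.ofReal (Real.exp (r * deviation ψ E i T (transcript x p y T ω))) ∂μ) /
          ENNReal.ofReal (Real.exp (s / T * s)) :=
        meas_ge_le_lintegral_div hmeas.aemeasurable hpos.ne' ENNReal.ofReal_ne_top
    _ ≤ ENNReal.ofReal (Real.exp (T * (r ^ 2 / 2))) / ENNReal.ofReal (Real.exp (s / T * s)) := by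
        gcongr
        exact hI.lintegral_exp_deviation_le hE i r le_rfl
    _ = _ := by
        rw [← ENNReal.ofReal_div_of_pos (Real.exp_pos _), ← Real.exp_sub, hr, mul_pow, hσ]
        congr 2
        field_simp
        ring

/-- A union bound over all events, coordinates and signs. -/
lemma IsInteraction.le_measure_forall_abs_deviation_le [IsProbabilityMeasure μ]
    (hI : IsInteraction T ψ μ x p y) (hT : 0 < T) {𝓔 : Type*} [Fintype 𝓔] {E : 𝓔 → Event X d}
    (hE : ∀ k, IsMeasurableEvent (E k)) {δ : ℝ} (hδ0 : 0 < δ) (hδ1 : δ < 1) :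
    ENNReal.ofReal (1 - δ) ≤ μ {ω | ∀ e i, |deviation ψ (E e) i T (transcript x p y T ω)| ≤
      √(2 * T * Real.log (Fintype.card (𝓔 × Fin d × ℤˣ) / δ))} := by
  have hT' : (0 : ℝ) < T := Nat.cast_pos.2 hT
  set m : ℕ := Fintype.card (𝓔 × Fin d × ℤˣ) with hm
  set s : ℝ := √(2 * T * Real.log (m / δ)) with hs
  set good : Set Ω := {ω | ∀ e i, |deviation ψ (E e) i T (transcript x p y T ω)| ≤ s} with hgood
  have htail : ∀ k : 𝓔 × Fin d × ℤˣ, μ {ω | s ≤ ((k.2.2 : ℤ) : ℝ) *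
      deviation ψ (E k.1) k.2.1 T (transcript x p y T ω)} ≤ ENNReal.ofReal (δ / m) := fun k => by
    have hm1 : (1 : ℝ) ≤ m := Nat.one_le_cast.2 (Fintype.card_pos_iff.2 ⟨k⟩)
    have hlog : 0 ≤ Real.log (m / δ) :=
      Real.log_nonneg ((one_le_div hδ0).2 (hδ1.le.trans hm1))
    refine (hI.measure_le_sign_mul_deviation_le hT (hE k.1) k.2.1 k.2.2
      (Real.sqrt_nonneg _)).trans_eq ?_
    rw [Real.sq_sqrt (by positivity), mul_div_cancel_left₀ _ (by positivity), ← Real.log_inv,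
      Real.exp_log (by positivity), inv_div]
  have hbad : μ goodᶜ ≤ ENNReal.ofReal δ := by
    calc μ goodᶜ ≤ μ (⋃ k : 𝓔 × Fin d × ℤˣ, {ω | s ≤ ((k.2.2 : ℤ) : ℝ) *
          deviation ψ (E k.1) k.2.1 T (transcript x p y T ω)}) := by
          refine measure_mono fun ω hω => ?_
          simp only [hgood, Set.mem_compl_iff, Set.mem_ofPred_eq, not_forall, not_le] at hω
          obtain ⟨e, i, hei⟩ := hω
          rw [Set.mem_iUnion]
          rcases abs_cases (deviation ψ (E e) i T (transcript x p y T ω)) with ⟨h, -⟩ | ⟨h, -⟩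
          · exact ⟨(e, i, 1), by simpa [h] using hei.le⟩
          · exact ⟨(e, i, -1), by simpa [h] using hei.le⟩
      _ ≤ ∑ k : 𝓔 × Fin d × ℤˣ, μ {ω | s ≤ ((k.2.2 : ℤ) : ℝ) *
          deviation ψ (E k.1) k.2.1 T (transcript x p y T ω)} := measure_iUnion_fintype_le _ _
      _ ≤ ∑ _k : 𝓔 × Fin d × ℤˣ, ENNReal.ofReal (δ / m) := sum_le_sum fun k _ => htail k
      _ = ENNReal.ofReal (m * (δ / m)) := by
          rw [sum_const, card_univ, nsmul_eq_mul, ENNReal.ofReal_mul (Nat.cast_nonneg _),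
            ENNReal.ofReal_natCast]
      _ ≤ ENNReal.ofReal δ := by
          refine ENNReal.ofReal_le_ofReal ?_
          rcases eq_or_ne (m : ℝ) 0 with h | h
          · simpa [h] using hδ0.le
          · rw [mul_div_cancel₀ _ h]
  rw [ENNReal.ofReal_sub _ hδ0.le, ENNReal.ofReal_one, tsub_le_iff_right]
  calc (1 : ENNReal) = μ (good ∪ goodᶜ) := by rw [Set.union_compl_self, measure_univ]
    _ ≤ μ good + μ goodᶜ := measure_union_le _ _
    _ ≤ μ good + ENNReal.ofReal δ := by gcongr

/-- The bias bound of the algorithm for arbitrary measurable events: with the learning rate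
`2 * √(log m / T)`, where `m` is the number of triples `(E, i, σ)`, all realized biases are of order
`√(T log (m / δ))`. -/
lemma IsUnbiasedPrediction.le_measure_forall_abs_bias_le [IsProbabilityMeasure μ] (hT : 0 < T)
    {𝓔 : Type*} [Fintype 𝓔] {E : 𝓔 → Event X d} (hE : ∀ k, IsMeasurableEvent (E k))
    (hcard : 2 ≤ Fintype.card (𝓔 × Fin d × ℤˣ))
    (hψ : IsUnbiasedPrediction T
      (2 * √(Real.log (Fintype.card (𝓔 × Fin d × ℤˣ)) / T)) (1 / (T : ℝ)) E ψ)
    (hI : IsInteraction T ψ μ x p y) {δ : ℝ} (hδ0 : 0 < δ) (hδ1 : δ < 1) :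
    ENNReal.ofReal (1 - δ) ≤ μ {ω | ∀ e i,
      |∑ t ∈ range T, realized (E e) x p y t ω * ((p t ω i : ℝ) - (y t ω i : ℝ))| ≤
        5 * √(T * Real.log (Fintype.card (𝓔 × Fin d × ℤˣ) / δ))} := by
  refine (hI.le_measure_forall_abs_deviation_le hT hE hδ0 hδ1).trans
    (measure_mono fun ω hω e i => ?_)
  have hT' : (0 : ℝ) < T := Nat.cast_pos.2 hT
  set m : ℝ := ((Fintype.card (𝓔 × Fin d × ℤˣ) : ℕ) : ℝ) with hm
  have hm2 : (2 : ℝ) ≤ m := Nat.ofNat_le_cast.2 hcard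
  have hL : 0.69 ≤ Real.log m := by
    linarith [Real.log_two_gt_d9, Real.log_le_log two_pos hm2]
  set a : ℝ := √(Real.log m / T) with ha
  have ha0 : 0 < a := Real.sqrt_pos.2 (by positivity)
  have ha2 : T * a ^ 2 = Real.log m := by
    rw [ha, Real.sq_sqrt (by positivity), mul_div_cancel₀ _ hT'.ne']
  have hmono : Real.log m ≤ Real.log (m / δ) :=
    Real.log_le_log (by positivity) ((le_div_iff₀ hδ0).2 (by nlinarith))
  have hbias : |expectedBias ψ (E e) i T (transcript x p y T ω)| ≤
      3 * √(T * Real.log (m / δ)) := by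
    have h1 := hψ.mul_abs_expectedBias_le ha0.le (by positivity) hE (transcript x p y T ω) e i
    rw [← hm] at h1
    have h2 : T * (a ^ 2 / 2 + 1 / (T : ℝ)) = Real.log m / 2 + 1 := by
      rw [← ha2]; field_simp
    have h3 : |expectedBias ψ (E e) i T (transcript x p y T ω)| ≤ 3 * (T * a) := by
      refine le_of_mul_le_mul_left ?_ ha0
      have : a * (3 * (T * a)) = 3 * Real.log m := by rw [← ha2]; ring
      linarith
    have h4 : T * a ≤ √(T * Real.log (m / δ)) := by
      refine Real.le_sqrt_of_sq_le ?_
      have : (T * a) ^ 2 = T * Real.log m := by rw [← ha2]; ring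
      rw [this]
      gcongr
    linarith
  have hdev : |deviation ψ (E e) i T (transcript x p y T ω)| ≤ 2 * √(T * Real.log (m / δ)) := by
    refine (hω e i).trans ?_
    rw [mul_assoc, Real.sqrt_mul two_pos.le]
    gcongr
    rw [Real.sqrt_le_left two_pos.le]
    norm_num
  have hsum := deviation_transcript ψ (E e) i T x p y ω
  rw [sub_eq_iff_eq_add.1 hsum.symm]
  refine (abs_add_le _ _).trans ?_
  linarith

end Concentration

/-! ### The events of the agents -/

section Agents

variable {X : Type*} [MeasurableSpace X] {d : ℕ}

/-- An event that depends on the transcript through a countable measurable parameter only is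
measurable. -/
lemma isMeasurableEvent_of_factor {ι : Type*} [Countable ι] [MeasurableSpace ι]
    [MeasurableSingletonClass ι] {E : Event X d} {F : ι → Cube d → unitInterval}
    (hF : ∀ i, Measurable (F i)) {c : ∀ t, Transcript X d t → ι} (hc : ∀ t, Measurable (c t))
    (hEF : ∀ t h x p, E t h x p = F (c t h) p) : IsMeasurableEvent E := by
  intro t
  simp_rw [hEF]
  have hF' : Measurable fun z : ι × Cube d => F z.1 z.2 :=
    measurable_from_prod_countable_right hF
  exact hF'.comp (((hc t).comp measurable_fst.fst).prodMk measurable_snd)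

open Classical in
lemma measurable_cbr_indicator {A : Type*} {u : A → Cube d → unitInterval}
    {cbr : Finset A → Cube d → A}
    (h : IsConstrainedBestResponse u cbr) (C : Finset A) (a : A) :
    Measurable fun p => if cbr C p = a then (1 : unitInterval) else 0 :=
  Measurable.ite (h.measurableSet C a) measurable_const measurable_const

variable {J : ℕ} {A N : Type*} [Fintype A]

lemma measurableSet_mem_candidates (g : Agent d J A) (t : ℕ) (a : A) :
    MeasurableSet {h : Transcript X d t | a ∈ candidates g t h} := by
  induction t with
  | zero => simp [candidates]
  | succ t ih =>
    have : {h : Transcript X d (t + 1) | a ∈ candidates g (t + 1) h} =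
        Fin.init ⁻¹' {h : Transcript X d t | a ∈ candidates g t h} ∩
          ⋂ j, {h | (g.c j a (h (Fin.last t)).2.2 : ℝ) ≤ 0} := by
      ext h
      simp [candidates]
    rw [this]
    refine (measurable_init t ih).inter (MeasurableSet.iInter fun j => ?_)
    exact measurableSet_le (measurable_subtype_coe.comp
      ((g.measurable_c j a).comp (measurable_last t).snd.snd)) measurable_const

lemma measurable_candidates [Fintype N] (agent : N → Agent d J A) (t : ℕ) :
    @Measurable _ _ _ ⊤ fun (h : Transcript X d t) n => candidates (agent n) t h := by
  refine @measurable_to_countable' _ _ ⊤ _ _ _ fun C => ?_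
  have : (fun (h : Transcript X d t) n => candidates (agent n) t h) ⁻¹' {C} =
      ⋂ n, ⋂ a, {h | a ∈ candidates (agent n) t h ↔ a ∈ C n} := by
    ext h
    simp [funext_iff, Finset.ext_iff]
  rw [this]
  refine MeasurableSet.iInter fun n => MeasurableSet.iInter fun a => ?_
  exact (measurableSet_mem_candidates (agent n) t a).iff (MeasurableSet.const _)

variable [Fintype N] {agent : N → Agent d J A} {cbr : N → Finset A → Cube d → A}

lemma isMeasurableEvent_cbrEvents
    (hcbr : ∀ n, IsConstrainedBestResponse (agent n).u (cbr n)) (e : N × A) :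
    IsMeasurableEvent (cbrEvents (X := X) agent cbr e) := by
  let _ : MeasurableSpace (N → Finset A) := ⊤
  exact isMeasurableEvent_of_factor (fun C => measurable_cbr_indicator (hcbr e.1) (C e.1) e.2)
    (measurable_candidates agent) fun _ _ _ _ => rfl

lemma exists_isUnbiasedPrediction_cbrEvents
    (hcbr : ∀ n, IsConstrainedBestResponse (agent n).u (cbr n)) (η : ℝ) {ε : ℝ} (hε : 0 < ε)
    (T : ℕ) : ∃ ψ : Forecaster X d, IsUnbiasedPrediction T η ε (cbrEvents agent cbr) ψ := by
  let _ : MeasurableSpace (N → Finset A) := ⊤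
  exact exists_isUnbiasedPrediction (isMeasurableEvent_cbrEvents hcbr)
    (fun e C => measurable_cbr_indicator (hcbr e.1) (C e.1) e.2)
    (measurable_candidates agent) (fun _ _ _ _ _ => rfl) η hε T

end Agents

lemma realized_cbrEvents_eq_one {X A N Ω : Type*} [Fintype A] [Subsingleton A] {d J : ℕ}
    (agent : N → Agent d J A) (cbr : N → Finset A → Cube d → A) (e : N × A) (x : ℕ → Ω → X)
    (p y : ℕ → Ω → Cube d) (t : ℕ) (ω : Ω) :
    realized (cbrEvents agent cbr e) x p y t ω = 1 := by
  simp [realized, cbrEvents, eq_iff_true_of_subsingleton]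

/-- The comparison of the two forms of the bound. If `M = 1`, then `log (M / δ)` may be arbitrarily
small, and the term with the number `S` of rounds in which the action is played takes over, since
there is just one action. -/
lemma sqrt_mul_log_two_mul_div_le {M T : ℕ} (hMT : 2 ≤ M * T) {δ S : ℝ} (hδ0 : 0 < δ)
    (hδ1 : δ < 1) (hS : M = 1 → S = T) :
    5 * √(T * Real.log (2 * M / δ)) ≤ 8 * (Real.log (M * T) + √(Real.log (M * T) * S)
      + √(Real.log (M / δ) * T)) := by
  have hM : 0 < M := Nat.pos_of_ne_zero (by rintro rfl; simp at hMT)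
  have hT : 0 < T := Nat.pos_of_ne_zero (by rintro rfl; simp at hMT)
  have hM' : (0 : ℝ) < M := Nat.cast_pos.2 hM
  have hT' : (0 : ℝ) < T := Nat.cast_pos.2 hT
  have hMT' : (2 : ℝ) ≤ M * T := by exact_mod_cast hMT
  have hlog : 0 ≤ Real.log (M * T) := Real.log_nonneg (by linarith)
  have hdiv : (M : ℝ) ≤ M / δ := (le_div_iff₀ hδ0).2 (by nlinarith)
  have hlogδ : 0 ≤ Real.log (M / δ) :=
    Real.log_nonneg ((Nat.one_le_cast.2 hM).trans hdiv)
  have hsplit : Real.log (2 * M / δ) = Real.log 2 + Real.log (M / δ) := by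
    rw [mul_div_assoc, Real.log_mul two_ne_zero (by positivity)]
  have h2 := Real.sqrt_nonneg (Real.log (M * T) * S)
  have h3 := Real.sqrt_nonneg (Real.log (M / δ) * T)
  rcases Nat.lt_or_ge 1 M with h | h
  · have hle : Real.log 2 ≤ Real.log (M / δ) :=
      Real.log_le_log two_pos (le_trans (by exact_mod_cast h) hdiv)
    have : √(T * Real.log (2 * M / δ)) ≤ 8 / 5 * √(Real.log (M / δ) * T) := by
      rw [Real.sqrt_le_left (by positivity), mul_pow, Real.sq_sqrt (by positivity), hsplit]
      nlinarith [mul_nonneg hlogδ hT'.le]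
    linarith
  · rw [hS (by lia)] at h2 ⊢
    have hle : Real.log 2 ≤ Real.log (M * T) := Real.log_le_log two_pos hMT'
    have : √(T * Real.log (2 * M / δ)) ≤ √(Real.log (M * T) * T) + √(Real.log (M / δ) * T) := by
      rw [Real.sqrt_le_left (by positivity), add_sq, Real.sq_sqrt (by positivity),
        Real.sq_sqrt (by positivity), hsplit]
      nlinarith [mul_nonneg h2 h3]
    linarith

end DecisionCalibration

end

theorem mainTheorem4 :
    ∃ C : ℝ, 0 < C ∧
      ∀ (d J T : ℕ) (X A N : Type*) [MeasurableSpace X] [Fintype A] [Fintype N]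
        (agent : N → DecisionCalibration.Agent d J A)
        (cbr : N → Finset A → DecisionCalibration.Cube d → A),
        (∀ n, DecisionCalibration.IsConstrainedBestResponse (agent n).u (cbr n)) →
        2 ≤ d * Fintype.card A * Fintype.card N * T →
        ∃ η : ℝ, 0 < η ∧
          (∀ ε : ℝ, 0 < ε → ∃ ψ : DecisionCalibration.Forecaster X d,
            DecisionCalibration.IsUnbiasedPrediction T η ε
              (DecisionCalibration.cbrEvents agent cbr) ψ) ∧
          ∀ ψ : DecisionCalibration.Forecaster X d,
            DecisionCalibration.IsUnbiasedPrediction T η (1 / (T : ℝ))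
              (DecisionCalibration.cbrEvents agent cbr) ψ →
            ∀ (Ω : Type*) [MeasurableSpace Ω] (μ : Measure Ω) [IsProbabilityMeasure μ]
              (x : ℕ → Ω → X) (p y : ℕ → Ω → DecisionCalibration.Cube d),
              DecisionCalibration.IsInteraction T ψ μ x p y →
              ∀ δ : ℝ, 0 < δ → δ < 1 →
                ENNReal.ofReal (1 - δ) ≤ μ {ω | ∀ (n : N) (a : A),
                  ‖(fun i : Fin d => ∑ t ∈ Finset.range T,
                      DecisionCalibration.realized (DecisionCalibration.cbrEvents agent cbr (n, a))
                        x p y t ω * ((p t ω i : ℝ) - (y t ω i : ℝ)))‖ ≤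
                    C * (Real.log (d * Fintype.card A * Fintype.card N * T)
                      + √(Real.log (d * Fintype.card A * Fintype.card N * T) *
                          ∑ t ∈ Finset.range T, DecisionCalibration.realized
                            (DecisionCalibration.cbrEvents agent cbr (n, a)) x p y t ω)
                      + √(Real.log (d * Fintype.card A * Fintype.card N / δ) * T))} := by
  refine ⟨8, by norm_num, ?_⟩
  intro d J T X A N _ _ _ agent cbr hcbr hcard
  set M : ℕ := d * Fintype.card A * Fintype.card N with hM
  have hT : 0 < T := Nat.pos_of_ne_zero (by rintro rfl; simp at hcard)
  have hM0 : 0 < M := Nat.pos_of_ne_zero (by intro h; simp [h] at hcard)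
  have hK : Fintype.card ((N × A) × Fin d × ℤˣ) = 2 * M := by
    simp only [Fintype.card_prod, Fintype.card_fin, Fintype.card_units_int, hM]
    ring
  have hMcast : (d * Fintype.card A * Fintype.card N : ℝ) = M := by rw [hM]; push_cast; rfl
  have hlogK : 0 < Real.log (Fintype.card ((N × A) × Fin d × ℤˣ)) :=
    Real.log_pos (Nat.one_lt_cast.2 (by lia))
  have hT' : (0 : ℝ) < T := Nat.cast_pos.2 hT
  refine ⟨2 * √(Real.log (Fintype.card ((N × A) × Fin d × ℤˣ)) / T), by positivity,
    fun ε hε => DecisionCalibration.exists_isUnbiasedPrediction_cbrEvents hcbr _ hε T, ?_⟩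
  intro ψ hψ Ω _ μ _ x p y hI δ hδ0 hδ1
  refine (hψ.le_measure_forall_abs_bias_le hT
    (DecisionCalibration.isMeasurableEvent_cbrEvents hcbr) (by lia) hI hδ0 hδ1).trans
    (measure_mono fun ω hω n a => ?_)
  -- A single action is played in every round, even once its candidate set is empty.
  have hS : M = 1 → ∑ t ∈ Finset.range T, DecisionCalibration.realized
      (DecisionCalibration.cbrEvents agent cbr (n, a)) x p y t ω = T := fun h => by
    have hA : Fintype.card A = 1 :=
      Nat.eq_one_of_mul_eq_one_left (Nat.eq_one_of_mul_eq_one_right h)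
    have := (Fintype.card_le_one_iff_subsingleton (α := A)).1 hA.le
    simp [DecisionCalibration.realized_cbrEvents_eq_one]
  have hbound := DecisionCalibration.sqrt_mul_log_two_mul_div_le hcard hδ0 hδ1 hS
  rw [hMcast]
  refine (pi_norm_le_iff_of_nonneg ((by positivity : (0 : ℝ) ≤ 5 * √(T *
    Real.log (2 * M / δ))).trans hbound)).2 fun i => (le_trans ?_ hbound)
  rw [Real.norm_eq_abs]
  refine (hω (n, a) i).trans_eq ?_
  rw [hK]
  push_cast
  rfl
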